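/- For $k\ge 0$ let $a_k(x)=\sum_{m=0}^{k}\binom{2k+1-m}{k-m}x^m\in\mathbb{R}[x]$, and for $n\ge 0$ let $H_n(x)=H_n^{(2,1)}(x)=\det[a_{i+j}(x)]_{0\le i,j\le n}$ be the associated $(n+1)\times(n+1)$ Hankel determinant. Then $H_0(x)=1$, $H_1(x)=1-2x$, and $$H_n(x)=2(1-x)H_{n-1}(x)-H_{n-2}(x)\qquad\text{for all } n\ge 2.$$ The polynomials $H_n$ form an orthogonal family: $\deg H_n=n$ for every $n\ge 0$, and there is a positive Borel measure $\mu$ on $\mathbb{R}$ with finite moments of all orders such that $\int H_mH_n\,d\mu=0$ for $m\ne n$ and $\int H_n^2\,d\mu>0$ for all $n$. Moreover, for all $n\ge 0$, $$H_n(x)=U_n(1-x)-U_{n-1}(1-x),$$ where $U_n$ denotes the Chebyshev polynomial of the second kind, with $U_{-1}=0$. -/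

import Mathlib

open Polynomial MeasureTheory

/-- The `(n+1) × (n+1)` Hankel determinant `det [a (i+j)]`, `0 ≤ i, j ≤ n`. -/
def hankelDet {R : Type*} [CommRing R] (a : ℕ → R) (n : ℕ) : R :=
  Matrix.det (Matrix.of fun i j : Fin (n + 1) => a ((i : ℕ) + (j : ℕ)))

/-- The polynomials `a_k(x) = ∑_{m=0}^k (2k+1-m choose k-m) x^m`.
The natural-number subtractions are exact, since `m ≤ k`. -/
noncomputable def a21 (k : ℕ) : ℝ[X] :=
  ∑ m ∈ Finset.range (k + 1), C (Nat.choose (2 * k + 1 - m) (k - m) : ℝ) * X ^ m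

/-- The polynomial `H_n(x) = det [a_{i+j}(x)]`, `0 ≤ i, j ≤ n`. -/
noncomputable def H21 (n : ℕ) : ℝ[X] := hankelDet a21 n

/-- A sequence `p_0, p_1, p_2, …` of real polynomials is an orthogonal family if `p_n` has degree
exactly `n` and there is a positive Borel measure on the real line with finite moments of all
orders for which the `p_n` are pairwise orthogonal and of positive norm. -/
def IsOrthogonalFamily (p : ℕ → ℝ[X]) : Prop :=
  (∀ n, (p n).degree = (n : WithBot ℕ)) ∧
    ∃ μ : Measure ℝ,
      (∀ q : ℝ[X], Integrable (fun x => q.eval x) μ) ∧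
      (∀ m n, m ≠ n → ∫ x, (p m).eval x * (p n).eval x ∂μ = 0) ∧
      (∀ n, 0 < ∫ x, (p n).eval x * (p n).eval x ∂μ)

/-! Put `y = 1 - x` and `z = (1 + u)² / u`. Then `a_k = [u^k] (1 + u)^(2k+2) / (1 + y u)` is the
`k`-th moment of `f ↦ [u⁰] f(z) (1 + u)² / (1 + y u)` (`a21_eq_coeff`, `constTermFunctional_X_pow`).
A unitriangular change of basis preserves the Hankel determinant, and the basis `tridiagBasis y`
makes the Gram matrix tridiagonal, with diagonal `1, 2y, 2y, …` and off-diagonal entries `1`.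
Expanding it gives the recurrence, hence the Chebyshev formula. Orthogonality follows from `(1 +
y)(U_m - U_{m-1})(U_n - U_{n-1}) = T_{m+n+1} + T_{m-n}`, integrated against `dy / √(1 - y²)`. -/

/-! ### Determinants -/

/-- Three-term recurrence for the determinants of the leading blocks of a tridiagonal matrix. -/
theorem det_tridiagonal {R : Type*} [CommRing R] (M : ℕ → ℕ → R)
    (hu : ∀ i j, i + 1 < j → M i j = 0) (hl : ∀ i j, j + 1 < i → M i j = 0) (n : ℕ) :
    (Matrix.of fun i j : Fin (n + 2) => M i j).det =
      M (n + 1) (n + 1) * (Matrix.of fun i j : Fin (n + 1) => M i j).det -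
        M (n + 1) n * M n (n + 1) * (Matrix.of fun i j : Fin n => M i j).det := by
  rw [Matrix.det_succ_row _ (Fin.last _), Fin.sum_univ_castSucc, Fin.sum_univ_castSucc,
    Finset.sum_eq_zero]
  -- The minor of the subdiagonal entry has a single nonzero entry in its last column.
  · rw [Matrix.det_succ_column _ (Fin.last _), Fin.sum_univ_castSucc, Finset.sum_eq_zero]
    · have h1 : (((Matrix.of fun i j : Fin (n + 2) => M i j).submatrix
          (Fin.last (n + 1)).succAbove (Fin.last n).castSucc.succAbove).submatrix
          (Fin.last n).succAbove (Fin.last n).succAbove) =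
          Matrix.of fun i j : Fin n => M i j := by
        ext i j
        simp [Fin.succAbove_of_castSucc_lt, Fin.lt_def]
      have h2 : ((Matrix.of fun i j : Fin (n + 2) => M i j).submatrix
          (Fin.last (n + 1)).succAbove (Fin.last (n + 1)).succAbove) =
          Matrix.of fun i j : Fin (n + 1) => M i j := by
        ext i j
        simp
      have h3 : (Fin.last n).castSucc.succAbove (Fin.last n) = Fin.last (n + 1) := by
        simp
      rw [h1, h2, Matrix.submatrix_apply, h3]
      simp only [Matrix.of_apply, Fin.succAbove_last, Fin.val_castSucc, Fin.val_last,
        ← two_mul, pow_mul, neg_one_sq, one_pow, one_mul, zero_add]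
      rw [show n + 1 + n = 2 * n + 1 by ring, pow_succ, pow_mul]
      simp only [neg_one_sq, one_pow]
      ring
    · intro i _
      rw [Matrix.submatrix_apply, Matrix.of_apply, hu]
      · simp
      · have := i.isLt
        simp
  · intro i _
    rw [Matrix.of_apply, hl]
    · simp
    · have := i.isLt
      simp

/-- A Hankel determinant may be computed in any basis of monic polynomials. -/
theorem hankelDet_eq_det_monic {R : Type*} [CommRing R] (L : R[X] →ₗ[R] R) (p : ℕ → R[X])
    (hdeg : ∀ i, (p i).natDegree = i) (hp : ∀ i, (p i).Monic) (n : ℕ) :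
    hankelDet (fun k => L (X ^ k)) n =
      (Matrix.of fun i j : Fin (n + 1) => L (p i * p j)).det := by
  set P : Matrix (Fin (n + 1)) (Fin (n + 1)) R := Matrix.of fun i j => (p j).coeff i with hP
  have hdet : P.det = 1 :=
    Matrix.det_matrixOfPolynomials (fun j : Fin (n + 1) => p j) (fun i => hdeg i) fun i => hp i
  have hsum (i : Fin (n + 1)) : p i = ∑ k : Fin (n + 1), (p i).coeff k • (X : R[X]) ^ (k : ℕ) := by
    conv_lhs => rw [(p i).as_sum_range' (n + 1) (by rw [hdeg]; exact i.isLt)]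
    rw [Fin.sum_univ_eq_sum_range (fun k => (p i).coeff k • (X : R[X]) ^ k)]
    simp [← C_mul_X_pow_eq_monomial, smul_eq_C_mul]
  have hmul : (Matrix.of fun i j : Fin (n + 1) => L (p i * p j)) =
      P.transpose * (Matrix.of fun i j : Fin (n + 1) => L (X ^ ((i : ℕ) + (j : ℕ)))) * P := by
    ext i j
    rw [Matrix.of_apply, hsum i, hsum j, Finset.sum_mul_sum, Finset.sum_comm]
    simp only [map_sum, Matrix.mul_apply, Finset.sum_mul]
    refine Finset.sum_congr rfl fun l _ => Finset.sum_congr rfl fun k _ => ?_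
    simp only [smul_mul_smul_comm, ← pow_add, map_smul, smul_eq_mul, hP, Matrix.of_apply,
      Matrix.transpose_apply]
    ring
  rw [hmul, Matrix.det_mul, Matrix.det_mul, Matrix.det_transpose, hdet]
  simp [hankelDet]

/-! ### The monic basis -/

/-- The monic polynomials with `p_i(u + 2 + u⁻¹) = u⁻ⁱ (1 + u²ⁱ⁺¹) / (1 + u)`. -/
noncomputable def halfAngle (R : Type*) [CommRing R] : ℕ → R[X]
  | 0 => 1
  | 1 => X - 3
  | n + 2 => (X - 2) * halfAngle R (n + 1) - halfAngle R n

theorem isMonicOfDegree_halfAngle (R : Type*) [CommRing R] [Nontrivial R] (n : ℕ) :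
    (halfAngle R n).IsMonicOfDegree n ∧ (halfAngle R (n + 1)).IsMonicOfDegree (n + 1) := by
  induction n with
  | zero =>
    refine ⟨by simp [halfAngle], ?_⟩
    have h := isMonicOfDegree_X_sub_one (3 : R)
    rwa [map_ofNat] at h
  | succ n ih =>
    refine ⟨ih.2, ?_⟩
    have h := isMonicOfDegree_X_sub_one (2 : R)
    rw [map_ofNat] at h
    have := h.mul ih.2
    rw [add_comm 1] at this
    refine this.sub ?_
    rw [ih.1.natDegree_eq]
    lia

/-- Since `z - 2 = u + u⁻¹`, both `u⁻ⁿ` and `uⁿ⁺¹` solve the recursion; powers of `u` are cleared to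
avoid inverses. -/
theorem aeval_halfAngle {R S : Type*} [CommRing R] [CommRing S] [Algebra R S] {u z : S}
    (h : u * z = (1 + u) ^ 2) (n : ℕ) :
    u ^ n * ((1 + u) * aeval z (halfAngle R n)) = 1 + u ^ (2 * n + 1) ∧
    u ^ (n + 1) * ((1 + u) * aeval z (halfAngle R (n + 1))) = 1 + u ^ (2 * n + 3) := by
  induction n with
  | zero =>
    simp only [halfAngle, map_sub, map_one, aeval_X, map_ofNat]
    constructor
    · ring
    · linear_combination (1 + u) * h
  | succ n ih =>
    refine ⟨ih.2, ?_⟩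
    simp only [halfAngle, map_sub, map_mul, aeval_X, map_ofNat]
    linear_combination (u * z - 2 * u) * ih.2 - u ^ 2 * ih.1 + (1 + u ^ (2 * n + 3)) * h

/-- The monic polynomials that make the form of `(1 + u)² / (1 + y u)` tridiagonal. -/
noncomputable def tridiagBasis {R : Type*} [CommRing R] (y : R) : ℕ → R[X]
  | 0 => 1
  | n + 1 => halfAngle R (n + 1) + C y * halfAngle R n

theorem isMonicOfDegree_tridiagBasis {R : Type*} [CommRing R] [Nontrivial R] (y : R) (n : ℕ) :
    (tridiagBasis y n).IsMonicOfDegree n := by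
  cases n with
  | zero => simp [tridiagBasis]
  | succ n =>
    obtain ⟨h0, h1⟩ := isMonicOfDegree_halfAngle R n
    refine h1.add_right ((natDegree_C_mul_le _ _).trans_lt ?_)
    rw [h0.natDegree_eq]
    lia

/-- The summand `1 + y u` is what cancels the denominator of the weight. -/
theorem aeval_tridiagBasis {R S : Type*} [CommRing R] [CommRing S] [Algebra R S] (y : R) {u z : S}
    (h : u * z = (1 + u) ^ 2) (n : ℕ) :
    u ^ (n + 1) * ((1 + u) * aeval z (tridiagBasis y (n + 1))) =
      (1 + algebraMap R S y * u) + u ^ (2 * (n + 1)) * (u + algebraMap R S y) := by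
  obtain ⟨h0, h1⟩ := aeval_halfAngle (R := R) h n
  simp only [tridiagBasis, map_add, map_mul, aeval_C]
  linear_combination h1 + algebraMap R S y * u * h0

/-! ### The constant-term functional -/

theorem algebraMap_laurentSeries (R : Type*) [CommRing R] (y : R) :
    algebraMap R (HahnSeries ℤ R) y = HahnSeries.C y := by
  rw [HahnSeries.algebraMap_apply', ← HahnSeries.ofPowerSeries_C]
  rfl

open scoped LaurentSeries in
/-- The `R`-linear functional `f ↦ [u⁰] f((1 + u)² / u) w(u)`. -/
noncomputable def constTermFunctional {R : Type*} [CommRing R] (w : PowerSeries R) :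
    R[X] →ₗ[R] R where
  toFun f := (aeval (HahnSeries.single (-1 : ℤ) (1 : R) *
    HahnSeries.ofPowerSeries ℤ R ((1 + PowerSeries.X) ^ 2)) f *
      HahnSeries.ofPowerSeries ℤ R w : R⸨X⸩).coeff 0
  map_add' f g := by simp [add_mul]
  map_smul' r f := by
    rw [smul_eq_C_mul, map_mul, aeval_C, algebraMap_laurentSeries, mul_assoc,
      HahnSeries.C_mul_eq_smul]
    rfl

open scoped LaurentSeries in
theorem constTermFunctional_eq_coeff {R : Type*} [CommRing R] (w P : PowerSeries R) (f : R[X])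
    (n : ℕ)
    (h : HahnSeries.ofPowerSeries ℤ R PowerSeries.X ^ n *
      (aeval (HahnSeries.single (-1 : ℤ) (1 : R) *
        HahnSeries.ofPowerSeries ℤ R ((1 + PowerSeries.X) ^ 2)) f *
      HahnSeries.ofPowerSeries ℤ R w : R⸨X⸩) = HahnSeries.ofPowerSeries ℤ R P) :
    constTermFunctional w f = PowerSeries.coeff n P := by
  rw [← HahnSeries.ofPowerSeries_apply_coeff (Γ := ℤ), ← h, ← map_pow,
    HahnSeries.ofPowerSeries_X_pow]
  have := HahnSeries.coeff_single_mul_add (r := (1 : R)) (b := (n : ℤ)) (a := 0)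
    (x := (aeval (HahnSeries.single (-1 : ℤ) (1 : R) *
      HahnSeries.ofPowerSeries ℤ R ((1 + PowerSeries.X) ^ 2)) f *
      HahnSeries.ofPowerSeries ℤ R w : R⸨X⸩))
  rw [zero_add, one_mul] at this
  exact this.symm

theorem ofPowerSeries_X_mul_joukowsky (R : Type*) [CommRing R] :
    HahnSeries.ofPowerSeries ℤ R PowerSeries.X * (HahnSeries.single (-1 : ℤ) (1 : R) *
      HahnSeries.ofPowerSeries ℤ R ((1 + PowerSeries.X) ^ 2)) =
      (1 + HahnSeries.ofPowerSeries ℤ R PowerSeries.X) ^ 2 := by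
  rw [← mul_assoc, HahnSeries.ofPowerSeries_X, HahnSeries.single_mul_single, map_pow, map_add,
    map_one, HahnSeries.ofPowerSeries_X]
  simp

theorem constTermFunctional_X_pow {R : Type*} [CommRing R] (w : PowerSeries R) (k : ℕ) :
    constTermFunctional w (X ^ k) =
      PowerSeries.coeff k ((1 + PowerSeries.X) ^ (2 * k) * w) := by
  apply constTermFunctional_eq_coeff
  rw [map_pow, aeval_X, ← mul_assoc, ← mul_pow, ofPowerSeries_X_mul_joukowsky]
  simp [pow_mul]

/-! ### The tridiagonal Gram matrix -/

/-- The power series `1 / (1 + y u)`. -/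
noncomputable def invOneAdd {R : Type*} [CommRing R] (y : R) : PowerSeries R :=
  PowerSeries.mk fun n => (-y) ^ n

theorem one_add_mul_invOneAdd {R : Type*} [CommRing R] (y : R) :
    (1 + PowerSeries.C y * PowerSeries.X) * invOneAdd y = 1 := by
  ext n
  cases n with
  | zero => simp [invOneAdd, add_mul, mul_assoc]
  | succ n =>
    simp [invOneAdd, add_mul, mul_assoc, PowerSeries.coeff_succ_X_mul, PowerSeries.coeff_one,
      pow_succ]
    ring

/-- The bilinear form of the weight `(1 + u)² / (1 + y u)` on the basis `tridiagBasis y`. -/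
noncomputable def tridiagForm {R : Type*} [CommRing R] (y : R) (i j : ℕ) : R :=
  constTermFunctional ((1 + PowerSeries.X) ^ 2 * invOneAdd y)
    (tridiagBasis y i * tridiagBasis y j)

theorem tridiagForm_comm {R : Type*} [CommRing R] (y : R) (i j : ℕ) :
    tridiagForm y i j = tridiagForm y j i := by
  rw [tridiagForm, tridiagForm, mul_comm (tridiagBasis y i)]

theorem tridiagForm_zero_zero {R : Type*} [CommRing R] (y : R) : tridiagForm y 0 0 = 1 := by
  rw [tridiagForm, constTermFunctional_eq_coeff (n := 0)
    (P := (1 + PowerSeries.X) ^ 2 * invOneAdd y)]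
  · simp [invOneAdd]
  · simp [tridiagBasis]

theorem tridiagForm_zero_succ {R : Type*} [CommRing R] (y : R) (j : ℕ) :
    tridiagForm y 0 (j + 1) = if j = 0 then 1 else 0 := by
  rw [tridiagForm, constTermFunctional_eq_coeff (n := j + 1)
    (P := 1 + PowerSeries.X + PowerSeries.X ^ (2 * (j + 1)) *
      ((1 + PowerSeries.X) * (PowerSeries.X + PowerSeries.C y) * invOneAdd y))]
  -- The tail has order at least `2(j + 1) > j + 1`, so only `1 + u` can contribute.
  · rw [map_add, PowerSeries.coeff_X_pow_mul', if_neg (by lia)]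
    simp [PowerSeries.coeff_one, PowerSeries.coeff_X]
  · have h := aeval_tridiagBasis y (ofPowerSeries_X_mul_joukowsky R) j
    have hg := congrArg (HahnSeries.ofPowerSeries ℤ R) (one_add_mul_invOneAdd y)
    simp only [map_add, map_mul, map_pow, map_one, HahnSeries.ofPowerSeries_C,
      tridiagBasis.eq_1, algebraMap_laurentSeries] at h hg ⊢
    linear_combination (1 + HahnSeries.ofPowerSeries ℤ R PowerSeries.X) *
      HahnSeries.ofPowerSeries ℤ R (invOneAdd y) * h +
        (1 + HahnSeries.ofPowerSeries ℤ R PowerSeries.X) * hg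

/-- The weight's factor `(1 + u)²` absorbs one `1 + u` from each basis element. Of the four products
only the two cross terms reach the required coefficient: each gives `y` when `i = j`, and one of
them gives `1` when the indices are adjacent. -/
theorem tridiagForm_succ_succ {R : Type*} [CommRing R] (y : R) (i j : ℕ) :
    tridiagForm y (i + 1) (j + 1) =
      if i = j then 2 * y else if i = j + 1 ∨ j = i + 1 then 1 else 0 := by
  rw [tridiagForm, constTermFunctional_eq_coeff (n := i + 1 + (j + 1))
    (P := 1 + PowerSeries.C y * PowerSeries.X +
      PowerSeries.X ^ (2 * (i + 1)) * (PowerSeries.X + PowerSeries.C y) +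
      PowerSeries.X ^ (2 * (j + 1)) * (PowerSeries.X + PowerSeries.C y) +
      PowerSeries.X ^ (2 * (i + 1) + 2 * (j + 1)) *
        ((PowerSeries.X + PowerSeries.C y) ^ 2 * invOneAdd y))]
  · simp only [map_add, PowerSeries.coeff_X_pow_mul', PowerSeries.coeff_one,
      PowerSeries.coeff_C_mul, PowerSeries.coeff_X, PowerSeries.coeff_C]
    rw [if_neg (by lia : ¬ i + 1 + (j + 1) = 0), if_neg (by lia : ¬ i + 1 + (j + 1) = 1),
      if_neg (by lia : ¬ 2 * (i + 1) + 2 * (j + 1) ≤ i + 1 + (j + 1))]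
    split_ifs <;> first | (exfalso; lia) | ring
  · have hi := aeval_tridiagBasis y (ofPowerSeries_X_mul_joukowsky R) i
    have hj := aeval_tridiagBasis y (ofPowerSeries_X_mul_joukowsky R) j
    have hg := congrArg (HahnSeries.ofPowerSeries ℤ R) (one_add_mul_invOneAdd y)
    have hij := congrArg₂ (· * ·) hi hj
    simp only [map_add, map_mul, map_pow, map_one, HahnSeries.ofPowerSeries_C,
      algebraMap_laurentSeries] at hij hg ⊢
    set u := HahnSeries.ofPowerSeries ℤ R PowerSeries.X
    linear_combination HahnSeries.ofPowerSeries ℤ R (invOneAdd y) * hij +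
      (1 + HahnSeries.C y * u + (u ^ (2 * (i + 1)) + u ^ (2 * (j + 1))) * (u + HahnSeries.C y)) * hg

theorem tridiagForm_eq_zero {R : Type*} [CommRing R] (y : R) {i j : ℕ} (h : i + 1 < j) :
    tridiagForm y i j = 0 := by
  obtain ⟨j, rfl⟩ : ∃ k, j = k + 1 := ⟨j - 1, by lia⟩
  cases i with
  | zero => rw [tridiagForm_zero_succ, if_neg (by lia)]
  | succ i => rw [tridiagForm_succ_succ, if_neg (by lia), if_neg (by lia)]

theorem hankelDet_coeff {R : Type*} [CommRing R] [Nontrivial R] (y : R) (n : ℕ) :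
    hankelDet (fun k => PowerSeries.coeff k ((1 + PowerSeries.X) ^ (2 * k + 2) * invOneAdd y)) n =
      (Matrix.of fun i j : Fin (n + 1) => tridiagForm y i j).det := by
  simp only [tridiagForm]
  rw [← hankelDet_eq_det_monic (constTermFunctional ((1 + PowerSeries.X) ^ 2 * invOneAdd y))
    (tridiagBasis y)
    (fun i => (isMonicOfDegree_tridiagBasis y i).natDegree_eq)
    (fun i => (isMonicOfDegree_tridiagBasis y i).monic)]
  congr 1
  ext k
  rw [constTermFunctional_X_pow, pow_add, mul_assoc]

/-! ### The entries `a_k` and the recurrence -/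

theorem coeff_one_add_X_pow_powerSeries (R : Type*) [CommRing R] (n k : ℕ) :
    PowerSeries.coeff k ((1 + PowerSeries.X : PowerSeries R) ^ n) = (n.choose k : R) := by
  rw [← Polynomial.coeff_one_add_X_pow R n k, ← Polynomial.coeff_coe]
  simp

/-- Write `1 + y u = (1 + u) - x u` and expand geometrically in `x u / (1 + u)`; stopping after `k +
1` terms leaves a multiple of `u^(k+1)`, invisible to the `k`-th coefficient. -/
theorem a21_eq_coeff (k : ℕ) :
    a21 k = PowerSeries.coeff k
      ((1 + PowerSeries.X) ^ (2 * k + 2) * invOneAdd (1 - X : ℝ[X])) := by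
  have hg := one_add_mul_invOneAdd (1 - X : ℝ[X])
  have hgeom := Commute.geom_sum₂_mul (Commute.all
    (PowerSeries.C (X : ℝ[X]) * PowerSeries.X) (1 + PowerSeries.X)) (k + 1)
  have hsum : (1 + PowerSeries.X) ^ (2 * k + 2) * invOneAdd (1 - X : ℝ[X]) =
      (∑ m ∈ Finset.range (k + 1), PowerSeries.C (X ^ m : ℝ[X]) *
        (PowerSeries.X ^ m * (1 + PowerSeries.X) ^ (2 * k + 1 - m))) +
      PowerSeries.X ^ (k + 1) * (PowerSeries.C (X ^ (k + 1) : ℝ[X]) *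
        (1 + PowerSeries.X) ^ (k + 1) * invOneAdd (1 - X : ℝ[X])) := by
    have : (∑ m ∈ Finset.range (k + 1), PowerSeries.C (X ^ m : ℝ[X]) *
        (PowerSeries.X ^ m * (1 + PowerSeries.X) ^ (2 * k + 1 - m))) =
        (1 + PowerSeries.X) ^ (k + 1) * ∑ m ∈ Finset.range (k + 1),
          (PowerSeries.C (X : ℝ[X]) * PowerSeries.X) ^ m *
            (1 + PowerSeries.X) ^ (k + 1 - 1 - m) := by
      rw [Finset.mul_sum]
      refine Finset.sum_congr rfl fun m hm => ?_
      rw [Finset.mem_range] at hm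
      rw [show 2 * k + 1 - m = (k + 1) + (k + 1 - 1 - m) by lia, map_pow]
      ring
    rw [this, map_pow]
    simp only [map_sub, map_one] at hg
    linear_combination (1 + PowerSeries.X) ^ (k + 1) * invOneAdd (1 - X : ℝ[X]) * hgeom +
      (1 + PowerSeries.X) ^ (k + 1) * (∑ m ∈ Finset.range (k + 1),
          (PowerSeries.C (X : ℝ[X]) * PowerSeries.X) ^ m *
            (1 + PowerSeries.X) ^ (k + 1 - 1 - m)) * hg
  rw [hsum, map_add, PowerSeries.coeff_X_pow_mul', if_neg (by lia), add_zero, map_sum, a21]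
  refine Finset.sum_congr rfl fun m hm => ?_
  rw [Finset.mem_range] at hm
  rw [PowerSeries.coeff_C_mul, PowerSeries.coeff_X_pow_mul', if_pos (by lia),
    coeff_one_add_X_pow_powerSeries, mul_comm, map_natCast]

theorem H21_eq_det (n : ℕ) :
    H21 n = (Matrix.of fun i j : Fin (n + 1) => tridiagForm (1 - X : ℝ[X]) i j).det := by
  rw [← hankelDet_coeff, H21]
  congr 1
  ext1 k
  exact a21_eq_coeff k

theorem H21_zero : H21 0 = 1 := by
  rw [H21_eq_det, Matrix.det_fin_one]
  exact tridiagForm_zero_zero _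

theorem H21_one : H21 1 = 1 - 2 * X := by
  rw [H21_eq_det, Matrix.det_fin_two]
  simp [tridiagForm_zero_zero, tridiagForm_zero_succ, tridiagForm_comm _ 1 0,
    tridiagForm_succ_succ _ 0 0]
  ring

theorem H21_add_two (n : ℕ) : H21 (n + 2) = 2 * (1 - X) * H21 (n + 1) - H21 n := by
  simp only [H21_eq_det]
  rw [det_tridiagonal (tridiagForm (1 - X : ℝ[X])) (fun i j => tridiagForm_eq_zero _)
    (fun i j h => by rw [tridiagForm_comm, tridiagForm_eq_zero _ h]),
    tridiagForm_succ_succ, tridiagForm_succ_succ, tridiagForm_succ_succ]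
  simp

/-! ### Chebyshev form and degree -/

theorem H21_eq_chebyshev (n : ℕ) : H21 n =
    (Chebyshev.U ℝ (n : ℤ)).comp (1 - X) - (Chebyshev.U ℝ ((n : ℤ) - 1)).comp (1 - X) := by
  induction n using Nat.twoStepInduction with
  | zero => simp [H21_zero]
  | one =>
    simp [H21_one]
    ring
  | more n h0 h1 =>
    have e1 := Chebyshev.U_add_two ℝ (n : ℤ)
    have e2 := Chebyshev.U_add_one ℝ (n : ℤ)
    rw [H21_add_two, h0, h1]
    push_cast
    rw [show (n : ℤ) + 2 - 1 = n + 1 by ring, show (n : ℤ) + 1 - 1 = n by ring, e1, e2]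
    simp only [sub_comp, mul_comp, ofNat_comp, X_comp]
    ring

theorem degree_H21 (n : ℕ) : (H21 n).degree = n := by
  have h : (Chebyshev.U ℝ (n : ℤ) - Chebyshev.U ℝ ((n : ℤ) - 1)).degree = n := by
    rw [degree_sub_eq_left_of_degree_lt, Chebyshev.degree_U_natCast]
    rw [Chebyshev.degree_U_natCast]
    cases n with
    | zero => simp
    | succ n =>
      rw [Nat.cast_succ, add_sub_cancel_right, Chebyshev.degree_U_natCast]
      exact_mod_cast n.lt_succ_self
  have hX : (1 - X : ℝ[X]).natDegree = 1 := by
    rw [← natDegree_neg, neg_sub]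
    exact natDegree_X_sub_C (1 : ℝ)
  have hne : H21 n ≠ 0 := by
    rw [H21_eq_chebyshev, ← sub_comp]
    intro h0
    rcases comp_eq_zero_iff.mp h0 with h0 | ⟨-, h0⟩
    · simp [h0] at h
    · rw [h0, natDegree_C] at hX
      exact zero_ne_one hX
  rw [degree_eq_natDegree hne, H21_eq_chebyshev, ← sub_comp, natDegree_comp, hX, mul_one,
    natDegree_eq_of_degree_eq_some h]

/-! ### Orthogonality -/

/-- The product of two half-angle cosines in terms of Chebyshev polynomials of the first kind. -/
theorem one_add_mul_U_sub_U_mul (m n : ℕ) :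
    (1 + X) * ((Chebyshev.U ℝ (m : ℤ) - Chebyshev.U ℝ ((m : ℤ) - 1)) *
      (Chebyshev.U ℝ (n : ℤ) - Chebyshev.U ℝ ((n : ℤ) - 1))) =
      Chebyshev.T ℝ (m + n + 1) + Chebyshev.T ℝ (m - n) := by
  have hbase : (1 + X) * (Chebyshev.U ℝ (n : ℤ) - Chebyshev.U ℝ ((n : ℤ) - 1)) =
      Chebyshev.T ℝ ((n : ℤ) + 1) + Chebyshev.T ℝ n := by
    have e := Chebyshev.T_eq_U_sub_X_mul_U ℝ ((n : ℤ) + 1)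
    rw [add_sub_cancel_right] at e
    rw [e, Chebyshev.T_eq_U_sub_X_mul_U ℝ (n : ℤ), Chebyshev.U_add_one]
    ring
  induction m using Nat.twoStepInduction with
  | zero =>
    simp only [Nat.cast_zero, zero_sub, zero_add, Chebyshev.U_zero, Chebyshev.U_neg_one,
      Chebyshev.T_neg]
    linear_combination hbase
  | one =>
    rw [← Chebyshev.T_neg ℝ (((1 : ℕ) : ℤ) - n), Nat.cast_one, neg_sub, sub_self,
      Chebyshev.U_zero, Chebyshev.U_one, show (1 + n + 1 : ℤ) = n + 2 by ring,
      Chebyshev.T_add_two, Chebyshev.T_sub_one]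
    linear_combination (2 * X - 1) * hbase
  | more m h0 h1 =>
    have e1 := Chebyshev.U_add_two ℝ (m : ℤ)
    have e2 := Chebyshev.U_add_one ℝ (m : ℤ)
    have e3 := Chebyshev.T_add_two ℝ (m + n + 1 : ℤ)
    have e4 := Chebyshev.T_add_two ℝ (m - n : ℤ)
    push_cast at h1 ⊢
    rw [show (m : ℤ) + 1 - 1 = m by ring, show (m : ℤ) + 1 + n + 1 = m + n + 1 + 1 by ring,
      show (m : ℤ) + 1 - n = m - n + 1 by ring] at h1
    rw [show (m : ℤ) + 2 - 1 = m + 1 by ring, show (m : ℤ) + 2 + n + 1 = m + n + 1 + 2 by ring,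
      show (m : ℤ) + 2 - n = m - n + 2 by ring, e1, e3, e4]
    rw [e2] at h1 ⊢
    linear_combination 2 * X * h1 - h0

theorem integral_measureT_H21 (m n : ℕ) :
    ∫ y, (1 + y) * ((H21 m).eval (1 - y) * (H21 n).eval (1 - y)) ∂Chebyshev.measureT =
      if m = n then Real.pi else 0 := by
  have h (y : ℝ) : (1 + y) * ((H21 m).eval (1 - y) * (H21 n).eval (1 - y)) =
      (Chebyshev.T ℝ (m + n + 1)).eval y + (Chebyshev.T ℝ (m - n)).eval y := by
    rw [← eval_add, ← one_add_mul_U_sub_U_mul]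
    simp [H21_eq_chebyshev]
  simp only [h]
  rw [integral_add (Chebyshev.integrable_measureT (by fun_prop))
    (Chebyshev.integrable_measureT (by fun_prop)),
    Chebyshev.integral_eval_T_real_measureT_of_ne_zero (by lia), zero_add]
  split_ifs with hmn
  · rw [hmn, sub_self, Chebyshev.integral_eval_T_real_measureT_zero]
  · exact Chebyshev.integral_eval_T_real_measureT_of_ne_zero (by lia)

/-- The image under `y ↦ 1 - y` of the measure `√((1 + y) / (1 - y)) dy` on `(-1, 1]`. -/
noncomputable def measureH : Measure ℝ :=
  (Chebyshev.measureT.withDensity fun y => ((1 + y).toNNReal : ENNReal)).map fun y => 1 - y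

theorem ae_measureT_mem : ∀ᵐ y ∂Chebyshev.measureT, y ∈ Set.Ioc (-1 : ℝ) 1 :=
  ae_restrict_mem measurableSet_Ioc

theorem integral_measureH (q : ℝ[X]) :
    ∫ x, q.eval x ∂measureH = ∫ y, (1 + y) * q.eval (1 - y) ∂Chebyshev.measureT := by
  rw [measureH, integral_map (by fun_prop) q.continuous.aestronglyMeasurable,
    integral_withDensity_eq_integral_smul (by fun_prop)]
  refine integral_congr_ae ?_
  filter_upwards [ae_measureT_mem] with y hy
  -- `toNNReal` truncates nothing here, because `y > -1` almost everywhere.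
  rw [NNReal.smul_def, Real.coe_toNNReal _ (by linarith [hy.1]), smul_eq_mul]

theorem integrable_measureH (q : ℝ[X]) : Integrable (fun x => q.eval x) measureH := by
  rw [measureH, integrable_map_measure q.continuous.aestronglyMeasurable (by fun_prop),
    integrable_withDensity_iff_integrable_smul (by fun_prop)]
  refine (Chebyshev.integrable_measureT (f := fun y => (1 + y) * q.eval (1 - y))
    (by fun_prop)).congr ?_
  filter_upwards [ae_measureT_mem] with y hy
  rw [NNReal.smul_def, Real.coe_toNNReal _ (by linarith [hy.1]), smul_eq_mul, Function.comp_apply]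

theorem integral_measureH_H21 (m n : ℕ) :
    ∫ x, (H21 m).eval x * (H21 n).eval x ∂measureH = if m = n then Real.pi else 0 := by
  simp only [← eval_mul]
  rw [integral_measureH, ← integral_measureT_H21]
  simp only [eval_mul]

theorem isOrthogonalFamily_H21 : IsOrthogonalFamily H21 :=
  ⟨degree_H21, measureH, integrable_measureH,
    fun m n h => by rw [integral_measureH_H21, if_neg h],
    fun n => by rw [integral_measureH_H21, if_pos rfl]; exact Real.pi_pos⟩

theorem mainTheorem9 :
    H21 0 = 1 ∧ H21 1 = 1 - 2 * X ∧
    (∀ n : ℕ, 2 ≤ n → H21 n = 2 * (1 - X) * H21 (n - 1) - H21 (n - 2)) ∧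
    IsOrthogonalFamily H21 ∧
    (∀ n : ℕ, H21 n =
      (Chebyshev.U ℝ (n : ℤ)).comp (1 - X) - (Chebyshev.U ℝ ((n : ℤ) - 1)).comp (1 - X)) := by
  refine ⟨H21_zero, H21_one, fun n hn => ?_, isOrthogonalFamily_H21, H21_eq_chebyshev⟩
  obtain ⟨k, rfl⟩ := Nat.exists_eq_add_of_le' hn
  exact H21_add_two k
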